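/- Let $d$ be an odd positive integer. An arrangement of $n$ hyperplanes in $\mathbb{R}^d$ is an indexed family $H_1,\dots,H_n$ of $(d-1)$-dimensional affine subspaces of $\mathbb{R}^d$. It is simple if, for $0\le k\le d$, any $k$ of the hyperplanes intersect in an affine subspace of dimension $d-k$, and any $d+1$ or more of them have empty intersection. Its topes are the connected components of $\mathbb{R}^d\setminus\bigcup_i H_i$. Its tope graph has the topes as vertices, two topes being adjacent if the intersection of their closures is a facet of each of the two closures. A 2-colouring of the tope graph is an assignment of one of two colours, burnt umber and chartreuse, to each tope such that adjacent topes receive different colours; $b$ and $c$ denote the numbers of topes coloured burnt umber and chartreuse, respectively. (i) For every $\varepsilon>0$ there is an integer $N$, depending only on $d$ and $\varepsilon$, such that for every $n\ge N$, every simple arrangement of $n$ hyperplanes in $\mathbb{R}^d$ and every 2-colouring of its tope graph, the number of topes is finite, $c>0$, and $$\frac{b}{c}\le 1+\varepsilon .$$ (ii) Consequently $$\limsup_{n\to\infty}\ \sup\frac{b}{c}=1,$$ where, for each $n$, the supremum (in $[0,\infty]$) is over all simple arrangements of $n$ hyperplanes in $\mathbb{R}^d$ and all 2-colourings of their tope graphs.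 -/

import Mathlib

open scoped ENNReal

/-- An arrangement of `n` hyperplanes in `ℝ^d`: an indexed family of
`(d - 1)`-dimensional affine subspaces. -/
structure HyperplaneArrangement (d n : ℕ) where
  /-- The hyperplanes of the arrangement. -/
  hyperplane : Fin n → AffineSubspace ℝ (EuclideanSpace ℝ (Fin d))
  nonempty : ∀ i, (hyperplane i : Set (EuclideanSpace ℝ (Fin d))).Nonempty
  finrank_direction : ∀ i, Module.finrank ℝ (hyperplane i).direction + 1 = d

/-- `F` is a facet of the closed polyhedron `P` in `ℝ^d`: a nonempty face (the set of points of `P`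
at which some linear functional attains its maximum over `P`) of dimension `d - 1`. -/
def IsFacet {d : ℕ} (P F : Set (EuclideanSpace ℝ (Fin d))) : Prop :=
  F.Nonempty ∧ IsExposed ℝ P F ∧ Module.finrank ℝ (affineSpan ℝ F).direction + 1 = d

namespace HyperplaneArrangement

variable {d n : ℕ}

/-- An arrangement is simple if, for `0 ≤ k ≤ d`, any `k` of the hyperplanes meet in an affine
subspace of dimension `d - k`, and any `d + 1` or more of them have empty intersection. -/
def IsSimple (A : HyperplaneArrangement d n) : Prop :=
  (∀ S : Finset (Fin n), S.card ≤ d →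
    (⋂ i ∈ S, (A.hyperplane i : Set (EuclideanSpace ℝ (Fin d)))).Nonempty ∧
    Module.finrank ℝ (⨅ i ∈ S, A.hyperplane i).direction + S.card = d) ∧
  (∀ S : Finset (Fin n), d < S.card →
    (⋂ i ∈ S, (A.hyperplane i : Set (EuclideanSpace ℝ (Fin d)))) = ∅)

/-- The complement of the union of the hyperplanes. -/
def complement (A : HyperplaneArrangement d n) : Set (EuclideanSpace ℝ (Fin d)) :=
  (⋃ i, (A.hyperplane i : Set (EuclideanSpace ℝ (Fin d))))ᶜ

/-- The topes: the connected components of the complement of the union of the hyperplanes. -/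
def topes (A : HyperplaneArrangement d n) : Set (Set (EuclideanSpace ℝ (Fin d))) :=
  {T | ∃ x ∈ A.complement, T = connectedComponentIn A.complement x}

/-- The tope graph: two topes are adjacent if the intersection of their closures is a facet
of each of these closures. -/
def topeGraph (A : HyperplaneArrangement d n) : SimpleGraph A.topes where
  Adj T T' := T ≠ T' ∧
    IsFacet (closure (T : Set (EuclideanSpace ℝ (Fin d)))) (closure T.1 ∩ closure T'.1) ∧
    IsFacet (closure (T' : Set (EuclideanSpace ℝ (Fin d)))) (closure T.1 ∩ closure T'.1)
  symm := ⟨fun T T' h => by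
    rw [Set.inter_comm (closure T'.1)]
    exact ⟨h.1.symm, h.2.2, h.2.1⟩⟩
  loopless := ⟨fun _ h => h.1 rfl⟩

/-- The number of topes that receive the colour `k` in a proper 2-colouring of the tope graph. -/
noncomputable def numTopes (A : HyperplaneArrangement d n) (C : A.topeGraph.Coloring Bool)
    (k : Bool) : ℕ :=
  (C.colorClass k).ncard

end HyperplaneArrangement

/-- The supremum in `[0, ∞]` of the ratios `b / c`, over all simple arrangements of `n` hyperplanes
in `ℝ^d` and all proper 2-colourings of their tope graphs, where `b` and `c` are the numbers of
topes of the two colours. -/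
noncomputable def supTopeRatio (d n : ℕ) : ℝ≥0∞ :=
  ⨆ (A : HyperplaneArrangement d n) (_ : A.IsSimple) (C : A.topeGraph.Coloring Bool),
    (A.numTopes C true : ℝ≥0∞) / (A.numTopes C false : ℝ≥0∞)

/-!
Describe each region by the set of hyperplanes on whose negative side it lies; crossing a facet
flips one hyperplane, so the tope graph is an induced subgraph of a hypercube. Fix a linear
functional that is non-constant on every line in which hyperplanes of the arrangement meet. Each of
the `n.choose d` vertices is the minimum of this functional on exactly one of the regions around
it, and a region has at most one minimum. The region opposite to it at the vertex is the one on
which the functional is maximal there; the two are joined by a path of `d` facet crossings, so for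
odd `d` they have different colours. Hence each colour is used at least `n.choose d / 2` times. By
the Sauer–Shelah lemma there are at most `∑ k ≤ d, n.choose k` regions in all, and the terms with
`k < d` are negligible. The supremum of the ratios is at least `1` because arrangements with
normals on the moment curve are simple, and their tope graphs have a 2-colouring by parity.
-/

open Function Module
open scoped Finset symmDiff Topology

section Polyhedron

variable {ι E : Type*} [AddCommGroup E] [Module ℝ E] {g : ι → E →ᵃ[ℝ] ℝ}

/-- The open polyhedron cut out by the strict inequalities `0 < g i x`. -/
def openPolyhedron (g : ι → E →ᵃ[ℝ] ℝ) : Set E := {x | ∀ i, 0 < g i x}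

/-- The closed polyhedron cut out by the inequalities `0 ≤ g i x`. -/
def closedPolyhedron (g : ι → E →ᵃ[ℝ] ℝ) : Set E := {x | ∀ i, 0 ≤ g i x}

/-- The face of the closed polyhedron of `g` on which its `i`-th inequality is tight; it may be
empty or of lower dimension than a facet. -/
def wall (g : ι → E →ᵃ[ℝ] ℝ) (i : ι) : Set E := {x ∈ closedPolyhedron g | g i x = 0}

theorem openPolyhedron_subset_closedPolyhedron : openPolyhedron g ⊆ closedPolyhedron g :=
  fun _ hx i => (hx i).le

theorem convex_openPolyhedron : Convex ℝ (openPolyhedron g) := by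
  simp only [openPolyhedron, Set.ofPred_forall]
  exact convex_iInter fun i => (convex_Ioi (0 : ℝ)).affine_preimage (g i)

theorem openSegment_subset_openPolyhedron {x p : E} (hx : x ∈ closedPolyhedron g)
    (hp : p ∈ openPolyhedron g) : openSegment ℝ x p ⊆ openPolyhedron g := by
  rintro _ ⟨a, b, ha, hb, hab, rfl⟩ i
  rw [Convex.combo_affine_apply hab]
  exact add_pos_of_nonneg_of_pos (mul_nonneg ha.le (hx i)) (mul_pos hb (hp i))

theorem eventually_lineMap_pos {f : E →ᵃ[ℝ] ℝ} {r : E} (hr : 0 < f r) (x : E) :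
    ∀ᶠ t in 𝓝[>] (0 : ℝ), 0 < f (AffineMap.lineMap r x t) := by
  have hcont : Continuous fun t : ℝ => f (AffineMap.lineMap r x t) := by
    simp only [AffineMap.apply_lineMap, AffineMap.lineMap_apply_ring]
    fun_prop
  refine nhdsWithin_le_nhds ((hcont.tendsto 0).eventually (lt_mem_nhds ?_))
  rwa [AffineMap.lineMap_apply_zero]

theorem exists_mem_wall {i : ι} {p q : E} (hp : p ∈ openPolyhedron g) (hqi : g i q < 0)
    (hq : ∀ j ≠ i, 0 < g j q) : ∃ r, g i r = 0 ∧ ∀ j ≠ i, 0 < g j r := by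
  have hpi := hp i
  have hpq : 0 < g i p - g i q := by linarith
  have hsum : -g i q / (g i p - g i q) + g i p / (g i p - g i q) = 1 := by
    rw [← add_div, neg_add_eq_sub, div_self hpq.ne']
  refine ⟨(-g i q / (g i p - g i q)) • p + (g i p / (g i p - g i q)) • q, ?_, fun j hj => ?_⟩
  · rw [Convex.combo_affine_apply hsum, smul_eq_mul, smul_eq_mul]
    ring
  · rw [Convex.combo_affine_apply hsum]
    exact add_pos (mul_pos (div_pos (neg_pos.2 hqi) hpq) (hp j))
      (mul_pos (div_pos hpi hpq) (hq j hj))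

theorem mem_wall_of_pos {i : ι} {r : E} (hri : g i r = 0) (hr : ∀ j ≠ i, 0 < g j r) :
    r ∈ wall g i := by
  refine ⟨fun j => ?_, hri⟩
  rcases eq_or_ne j i with rfl | hj
  · exact hri.ge
  · exact (hr j hj).le

theorem affineSpan_wall [Finite ι] {i : ι} {H : AffineSubspace ℝ E}
    (hH : ∀ x, x ∈ H ↔ g i x = 0) {r : E} (hri : g i r = 0) (hr : ∀ j ≠ i, 0 < g j r) :
    affineSpan ℝ (wall g i) = H := by
  refine le_antisymm (affineSpan_le.2 fun x hx => (hH x).2 hx.2) fun x hx => ?_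
  have hpos : ∀ᶠ t in 𝓝[>] (0 : ℝ), ∀ j ≠ i, 0 < g j (AffineMap.lineMap r x t) :=
    Filter.eventually_all.2 fun j =>
      Filter.eventually_imp_distrib_left.2 fun hj => eventually_lineMap_pos (hr j hj) x
  obtain ⟨t, ht, ht0⟩ := (hpos.and self_mem_nhdsWithin).exists
  have hti : g i (AffineMap.lineMap r x t) = 0 :=
    (hH _).1 (AffineMap.lineMap_mem t ((hH r).2 hri) hx)
  have hspan := AffineMap.lineMap_mem t⁻¹ (subset_affineSpan ℝ _ (mem_wall_of_pos hri hr))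
    (subset_affineSpan ℝ _ (mem_wall_of_pos hti ht))
  rwa [AffineMap.lineMap_lineMap_right, inv_mul_cancel₀ (ne_of_gt ht0),
    AffineMap.lineMap_apply_one] at hspan

variable [TopologicalSpace E] [IsTopologicalAddGroup E]

theorem closure_openPolyhedron [ContinuousSMul ℝ E] (hg : ∀ i, Continuous (g i))
    (hne : (openPolyhedron g).Nonempty) : closure (openPolyhedron g) = closedPolyhedron g := by
  refine (closure_minimal openPolyhedron_subset_closedPolyhedron ?_).antisymm fun x hx => ?_
  · simp only [closedPolyhedron, Set.ofPred_forall]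
    exact isClosed_iInter fun i => isClosed_le continuous_const (hg i)
  · obtain ⟨p, hp⟩ := hne
    exact closure_mono (openSegment_subset_openPolyhedron hx hp)
      (segment_subset_closure_openSegment (left_mem_segment ℝ x p))

theorem isExposed_wall {i : ι} (hg : Continuous (g i)) :
    IsExposed ℝ (closedPolyhedron g) (wall g i) := by
  rintro ⟨r, hr, hri⟩
  let l : StrongDual ℝ E := -⟨(g i).linear, AffineMap.continuous_linear_iff.2 hg⟩
  have hl : ∀ x y, l y ≤ l x ↔ g i x ≤ g i y := fun x y => by
    rw [← sub_nonneg, ← sub_nonneg (a := g i y), ← map_sub, ← vsub_eq_sub (g i y),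
      ← AffineMap.linearMap_vsub, ← neg_vsub_eq_vsub_rev, map_neg]
    rfl
  refine ⟨l, Set.ext fun x => and_congr_right fun hx => ?_⟩
  simp only [hl]
  exact ⟨fun hxi y hy => hxi ▸ hy i, fun hmin => le_antisymm (hri ▸ hmin r hr) (hx i)⟩

end Polyhedron

section Reorientation

variable {ι E : Type*} [DecidableEq ι] [AddCommGroup E] [Module ℝ E]
  {f : ι → E →ᵃ[ℝ] ℝ} {S T : Finset ι} {i : ι} {x : E}

/-- The family obtained from `f` by changing the sign of the members indexed by `S`. Thus
`openPolyhedron (reorient f S)` is the region where exactly the functionals indexed by `S` are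
negative and none vanishes. -/
def reorient (f : ι → E →ᵃ[ℝ] ℝ) (S : Finset ι) (i : ι) : E →ᵃ[ℝ] ℝ :=
  if i ∈ S then -f i else f i

/-- The sets `S` for which the open region where exactly the functionals indexed by `S` are
negative is inhabited. -/
def signPatterns (f : ι → E →ᵃ[ℝ] ℝ) : Set (Finset ι) :=
  {S | (openPolyhedron (reorient f S)).Nonempty}

theorem reorient_apply : reorient f S i x = if i ∈ S then -f i x else f i x := by
  unfold reorient
  split_ifs <;> rfl

theorem reorient_apply_eq_zero_iff : reorient f S i x = 0 ↔ f i x = 0 := by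
  rw [reorient_apply]
  split_ifs <;> simp only [neg_eq_zero]

theorem reorient_apply_of_mem_symmDiff (hi : i ∈ S ∆ T) :
    reorient f S i x = -reorient f T i x := by
  rw [Finset.mem_symmDiff] at hi
  rcases hi with ⟨hS, hT⟩ | ⟨hT, hS⟩ <;> simp [reorient_apply, hS, hT]

theorem reorient_apply_of_notMem_symmDiff (hi : i ∉ S ∆ T) :
    reorient f S i x = reorient f T i x := by
  have hST : i ∈ S ↔ i ∈ T := by
    rw [Finset.mem_symmDiff] at hi
    tauto
  simp only [reorient_apply, hST]

theorem mem_openPolyhedron_reorient_iff :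
    x ∈ openPolyhedron (reorient f S) ↔ ∀ i, f i x ≠ 0 ∧ (i ∈ S ↔ f i x < 0) := by
  refine forall_congr' fun i => ?_
  rw [reorient_apply]
  by_cases hi : i ∈ S <;> simp only [hi, if_true, if_false, neg_pos, true_iff, false_iff, not_lt]
  · exact ⟨fun h => ⟨h.ne, h⟩, And.right⟩
  · exact ⟨fun h => ⟨h.ne', h.le⟩, fun h => h.2.lt_of_ne h.1.symm⟩

theorem eq_of_mem_openPolyhedron_reorient (hS : x ∈ openPolyhedron (reorient f S))
    (hT : x ∈ openPolyhedron (reorient f T)) : S = T := by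
  rw [mem_openPolyhedron_reorient_iff] at hS hT
  exact Finset.ext fun i => (hS i).2.trans (hT i).2.symm

theorem openPolyhedron_reorient_injOn :
    Set.InjOn (fun S => openPolyhedron (reorient f S)) (signPatterns f) := by
  rintro S ⟨x, hx⟩ T - h
  exact eq_of_mem_openPolyhedron_reorient hx (h.subset hx)

theorem exists_mem_openPolyhedron_reorient [Finite ι] (hx : ∀ i, f i x ≠ 0) :
    ∃ S : Finset ι, x ∈ openPolyhedron (reorient f S) := by
  have hfin := Set.toFinite {i | f i x < 0}
  exact ⟨hfin.toFinset, mem_openPolyhedron_reorient_iff.2 fun i => ⟨hx i, hfin.mem_toFinset⟩⟩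

theorem closedPolyhedron_reorient_inter :
    closedPolyhedron (reorient f S) ∩ closedPolyhedron (reorient f T) =
      {x ∈ closedPolyhedron (reorient f S) | ∀ i ∈ S ∆ T, f i x = 0} := by
  refine Set.ext fun x => and_congr_right fun hxS => ⟨fun hxT i hi => ?_, fun h i => ?_⟩
  · have hnonneg := hxS i
    rw [reorient_apply_of_mem_symmDiff hi, neg_nonneg] at hnonneg
    exact reorient_apply_eq_zero_iff.1 (hnonneg.antisymm (hxT i))
  · by_cases hi : i ∈ S ∆ T
    · exact (reorient_apply_eq_zero_iff.2 (h i hi)).ge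
    · exact (hxS i).trans_eq (reorient_apply_of_notMem_symmDiff hi)

theorem closedPolyhedron_reorient_inter_eq_wall (h : S ∆ T = {i}) :
    closedPolyhedron (reorient f S) ∩ closedPolyhedron (reorient f T) =
      wall (reorient f S) i := by
  simp only [closedPolyhedron_reorient_inter, h, Finset.mem_singleton, forall_eq, wall,
    reorient_apply_eq_zero_iff]

theorem exists_mem_wall_reorient (h : S ∆ T = {i}) (hS : S ∈ signPatterns f)
    (hT : T ∈ signPatterns f) :
    ∃ r, reorient f S i r = 0 ∧ ∀ j ≠ i, 0 < reorient f S j r := by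
  obtain ⟨p, hp⟩ := hS
  obtain ⟨q, hq⟩ := hT
  refine exists_mem_wall hp (q := q) ?_ fun j hj => ?_
  · rw [reorient_apply_of_mem_symmDiff (h ▸ Finset.mem_singleton_self i), neg_lt_zero]
    exact hq i
  · rw [reorient_apply_of_notMem_symmDiff (by rwa [h, Finset.mem_singleton])]
    exact hq j

variable [TopologicalSpace E]

theorem continuous_reorient (hf : ∀ i, Continuous (f i)) (S : Finset ι) (i : ι) :
    Continuous (reorient f S i) := by
  unfold reorient
  split_ifs
  exacts [(hf i).neg, hf i]

theorem connectedComponentIn_eq_openPolyhedron [IsTopologicalAddGroup E] [ContinuousSMul ℝ E]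
    (hf : ∀ i, Continuous (f i))
    (hx : x ∈ openPolyhedron (reorient f S)) :
    connectedComponentIn {y | ∀ i, f i y ≠ 0} x = openPolyhedron (reorient f S) := by
  have hsub : openPolyhedron (reorient f S) ⊆ {y | ∀ i, f i y ≠ 0} :=
    fun y hy i => (mem_openPolyhedron_reorient_iff.1 hy i).1
  refine Set.Subset.antisymm (fun y hy i => ?_)
    (convex_openPolyhedron.isPreconnected.subset_connectedComponentIn hx hsub)
  by_contra! hneg
  obtain ⟨z, hz, hz0⟩ := isPreconnected_connectedComponentIn.intermediate_value hy
    (mem_connectedComponentIn (hsub hx)) (continuous_reorient hf S i).continuousOn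
    ⟨hneg, (hx i).le⟩
  exact connectedComponentIn_subset _ x hz i (reorient_apply_eq_zero_iff.1 hz0)

end Reorientation

section Hypercube

variable {ι : Type*} [DecidableEq ι] {S T I : Finset ι}

theorem even_card_symmDiff_iff : Even #(S ∆ T) ↔ (Even #S ↔ Even #T) := by
  have hS := Finset.card_sdiff_add_card_inter S T
  have hT := Finset.card_sdiff_add_card_inter T S
  rw [Finset.inter_comm T S] at hT
  rw [Finset.symmDiff_def, Finset.card_union_of_disjoint disjoint_sdiff_sdiff, ← hS, ← hT]
  simp only [Nat.even_add]
  tauto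

/-- The hypercube graph on the finite subsets of `ι`: two sets are adjacent when they differ in
exactly one element. Its subgraph induced on the sign patterns models the tope graph. -/
def hypercubeGraph (ι : Type*) [DecidableEq ι] : SimpleGraph (Finset ι) where
  Adj S T := #(S ∆ T) = 1
  symm := ⟨fun S T h => by rwa [symmDiff_comm]⟩
  loopless := ⟨fun S h => by simp at h⟩

theorem hypercubeGraph_adj_iff : (hypercubeGraph ι).Adj S T ↔ ∃ i, S ∆ T = {i} :=
  Finset.card_eq_one

/-- The proper 2-colouring of the hypercube graph by the parity of the cardinality. -/
def parityColoring (ι : Type*) [DecidableEq ι] : (hypercubeGraph ι).Coloring Bool :=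
  .mk (fun S => decide (Even #S)) fun {S T} h => by
    have hodd : ¬ Even #(S ∆ T) := by rw [show #(S ∆ T) = 1 from h]; exact Nat.not_even_one
    rwa [ne_eq, decide_eq_decide, ← even_card_symmDiff_iff]

theorem exists_walk_symmDiff {P : Set (Finset ι)} (h : ∀ J ⊆ I, S ∆ J ∈ P) (hS : S ∈ P) :
    ∃ p : ((hypercubeGraph ι).induce P).Walk ⟨S, hS⟩ ⟨S ∆ I, h I subset_rfl⟩, p.length = #I := by
  induction I using Finset.induction_on with
  | empty => exact ⟨SimpleGraph.Walk.nil.copy rfl (Subtype.ext (symmDiff_bot S).symm), by simp⟩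
  | insert i I hi ih =>
    obtain ⟨p, hp⟩ := ih fun J hJ => h J (hJ.trans (Finset.subset_insert i I))
    have hadj : (hypercubeGraph ι).Adj (S ∆ I) (S ∆ insert i I) := by
      refine hypercubeGraph_adj_iff.2 ⟨i, ?_⟩
      rw [symmDiff_symmDiff_symmDiff_comm, symmDiff_self, bot_symmDiff]
      ext j
      simp only [Finset.mem_symmDiff, Finset.mem_insert, Finset.mem_singleton]
      grind
    exact ⟨p.concat (SimpleGraph.comap_adj.2 hadj), by
      rw [SimpleGraph.Walk.length_concat, hp, Finset.card_insert_of_notMem hi]⟩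

theorem coloring_symmDiff_ne {P : Set (Finset ι)} (C : ((hypercubeGraph ι).induce P).Coloring Bool)
    (hI : Odd #I) (h : ∀ J ⊆ I, S ∆ J ∈ P) (hS : S ∈ P) :
    C ⟨S ∆ I, h I subset_rfl⟩ ≠ C ⟨S, hS⟩ := by
  obtain ⟨p, hp⟩ := exists_walk_symmDiff h hS
  have hodd := (C.odd_length_iff_not_congr p).1 (hp ▸ hI)
  grind

end Hypercube

section UpperBound

variable {ι E : Type*} [DecidableEq ι] [AddCommGroup E] [Module ℝ E]
  {f : ι → E →ᵃ[ℝ] ℝ} {P : Finset (Finset ι)} {s : Finset ι}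

theorem linearIndepOn_linear_of_shatters (hP : ↑P ⊆ signPatterns f) (hs : P.Shatters s) :
    LinearIndepOn ℝ (fun i => (f i).linear) (s : Set ι) := by
  by_contra hdep
  obtain ⟨c, hc, i, hi, hci⟩ :
      ∃ c : ι → ℝ, ∑ i ∈ s, c i • (f i).linear = 0 ∧ ∃ i ∈ s, c i ≠ 0 := by
    simpa only [linearIndepOn_finset_iff, not_forall, exists_prop] using hdep
  obtain ⟨S, hS, hSc⟩ := hs (Finset.filter_subset (c · < 0) s)
  obtain ⟨T, hT, hTc⟩ := hs (Finset.filter_subset (¬ c · < 0) s)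
  obtain ⟨x, hx⟩ := hP hS
  obtain ⟨y, hy⟩ := hP hT
  rw [mem_openPolyhedron_reorient_iff] at hx hy
  have hx_neg : ∀ j ∈ s, f j x < 0 ↔ c j < 0 := fun j hj => by
    simpa [hj, (hx j).2] using Finset.ext_iff.1 hSc j
  have hy_neg : ∀ j ∈ s, f j y < 0 ↔ ¬ c j < 0 := fun j hj => by
    simpa [hj, (hy j).2] using Finset.ext_iff.1 hTc j
  have hpos : ∀ j ∈ s, c j ≠ 0 → 0 < c j * (f j x - f j y) := fun j hj hcj => by
    rcases hcj.lt_or_gt with hneg | hpos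
    · have hyj := le_of_not_gt (mt (hy_neg j hj).1 (not_not.2 hneg))
      exact mul_pos_of_neg_of_neg hneg (by linarith [(hx_neg j hj).2 hneg])
    · have hxj := le_of_not_gt (mt (hx_neg j hj).1 hpos.not_gt)
      exact mul_pos hpos (by linarith [(hy_neg j hj).2 hpos.not_gt])
  have hsum_pos : 0 < ∑ j ∈ s, c j * (f j x - f j y) :=
    Finset.sum_pos'
      (fun j hj => (eq_or_ne (c j) 0).elim (fun h0 => by simp [h0]) fun h0 => (hpos j hj h0).le)
      ⟨i, hi, hpos i hi hci⟩
  have hsum_zero : ∑ j ∈ s, c j * (f j x - f j y) = 0 := by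
    simpa only [LinearMap.sum_apply, LinearMap.smul_apply, smul_eq_mul, AffineMap.linearMap_vsub,
      vsub_eq_sub (f _ x), LinearMap.zero_apply] using LinearMap.congr_fun hc (x -ᵥ y)
  exact hsum_pos.ne' hsum_zero

variable [FiniteDimensional ℝ E]

theorem card_le_finrank_of_shatters (hP : ↑P ⊆ signPatterns f) (hs : P.Shatters s) :
    #s ≤ finrank ℝ E := by
  simpa using (linearIndepOn_linear_of_shatters hP hs).fintype_card_le_finrank

theorem ncard_signPatterns_le [Fintype ι] (f : ι → E →ᵃ[ℝ] ℝ) :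
    (signPatterns f).ncard ≤ ∑ k ∈ Finset.range (finrank ℝ E + 1), (Fintype.card ι).choose k := by
  rw [Nat.range_succ_eq_Iic, Set.ncard_eq_toFinset_card (signPatterns f)]
  set P := (Set.toFinite (signPatterns f)).toFinset
  have hvc : P.vcDim ≤ finrank ℝ E := Finset.sup_le fun s hs =>
    card_le_finrank_of_shatters (Set.Finite.coe_toFinset _).subset (Finset.mem_shatterer.1 hs)
  calc #P ≤ #P.shatterer := P.card_le_card_shatterer
    _ ≤ ∑ k ∈ Finset.Iic P.vcDim, (Fintype.card ι).choose k := Finset.card_shatterer_le_sum_vcDim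
    _ ≤ _ := Finset.sum_le_sum_of_subset (Finset.Iic_subset_Iic.2 hvc)

end UpperBound

theorem card_le_two_mul_ncard_of_injective_of_ne {α β : Type*} [Finite β] {φ ψ : α → β}
    (hφ : Injective φ) (hψ : Injective ψ) {c : β → Bool} (h : ∀ a, c (φ a) ≠ c (ψ a)) (k : Bool) :
    Nat.card α ≤ 2 * {b | c b = k}.ncard := by
  have hcover : (Set.univ : Set α) = {a | c (φ a) = k} ∪ {a | c (ψ a) = k} :=
    (Set.eq_univ_of_forall fun a => by
      by_contra hk
      exact h a ((Bool.eq_not.2 (mt Or.inl hk)).trans (Bool.eq_not.2 (mt Or.inr hk)).symm)).symm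
  calc Nat.card α = (Set.univ : Set α).ncard := (Set.ncard_univ α).symm
    _ ≤ {a | c (φ a) = k}.ncard + {a | c (ψ a) = k}.ncard := hcover ▸ Set.ncard_union_le _ _
    _ ≤ {b | c b = k}.ncard + {b | c b = k}.ncard :=
      add_le_add (Set.ncard_le_ncard_of_injOn φ (fun _ => id) hφ.injOn)
        (Set.ncard_le_ncard_of_injOn ψ (fun _ => id) hψ.injOn)
    _ = 2 * {b | c b = k}.ncard := (two_mul _).symm

section GeneralPosition

variable {ι E : Type*} [AddCommGroup E] [Module ℝ E] {f : ι → E →ᵃ[ℝ] ℝ}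

/-- A family of affine functionals is in general position if the functionals of any subfamily of at
most `finrank ℝ E` members take arbitrary values independently, and no more than `finrank ℝ E`
members vanish at a common point. This is simplicity of the arrangement of zero sets. -/
structure InGeneralPosition (f : ι → E →ᵃ[ℝ] ℝ) : Prop where
  surjective_pi : ∀ S : Finset ι, #S ≤ finrank ℝ E → Surjective (AffineMap.pi fun i : S => f i)
  card_le_finrank : ∀ (S : Finset ι) (x : E), (∀ i ∈ S, f i x = 0) → #S ≤ finrank ℝ E

namespace InGeneralPosition

variable [FiniteDimensional ℝ E] (hf : InGeneralPosition f)
  (I : Set.powersetCard ι (finrank ℝ E)) {S : Finset ι} {i : ι} {x : E}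
include hf

theorem bijective_pi : Bijective (AffineMap.pi fun i : I.1 => f i) := by
  have hsurj := hf.surjective_pi I.1 (Set.powersetCard.card_eq I).le
  rw [← AffineMap.linear_surjective_iff] at hsurj
  have hcard : finrank ℝ E = finrank ℝ (I.1 → ℝ) := by
    rw [finrank_fintype_fun_eq_card, Fintype.card_coe, Set.powersetCard.card_eq I]
  rw [← AffineMap.linear_bijective_iff]
  exact ⟨(LinearMap.injective_iff_surjective_of_finrank_eq_finrank hcard).2 hsurj, hsurj⟩

/-- The affine coordinate system formed by the functionals indexed by `I`. -/
noncomputable def chart : E ≃ᵃ[ℝ] (I.1 → ℝ) := AffineEquiv.ofBijective (hf.bijective_pi I)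

theorem apply_chart_symm (hi : i ∈ I.1) (y : I.1 → ℝ) : f i ((hf.chart I).symm y) = y ⟨i, hi⟩ :=
  congrFun ((hf.chart I).apply_symm_apply y) ⟨i, hi⟩

/-- The common zero of the functionals indexed by `I`. -/
noncomputable def vertex : E := (hf.chart I).symm 0

theorem apply_vertex (hi : i ∈ I.1) : f i (hf.vertex I) = 0 :=
  hf.apply_chart_symm I hi 0

theorem eq_vertex (hx : ∀ i ∈ I.1, f i x = 0) : x = hf.vertex I :=
  ((hf.chart I).symm_apply_eq.2 (funext fun i => (hx i.1 i.2).symm)).symm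

theorem apply_vertex_eq_zero_iff : f i (hf.vertex I) = 0 ↔ i ∈ I.1 := by
  classical
  refine ⟨fun h0 => by_contra fun hi => ?_, hf.apply_vertex I⟩
  have hcard := hf.card_le_finrank (insert i I.1) (hf.vertex I)
    (Finset.forall_mem_insert _ _ _ |>.2 ⟨h0, fun j => hf.apply_vertex I⟩)
  rw [Finset.card_insert_of_notMem hi, Set.powersetCard.card_eq I] at hcard
  exact hcard.not_gt (Nat.lt_succ_self _)

theorem vertex_injective : Injective hf.vertex := fun I J h =>
  Subtype.ext <| Finset.ext fun i => by
    rw [← hf.apply_vertex_eq_zero_iff I, h, hf.apply_vertex_eq_zero_iff J]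

variable [DecidableEq ι]

/-- The direction in which the `i`-th functional grows at unit rate while the other functionals
indexed by `I` stay constant; it is zero for `i ∉ I`. -/
noncomputable def edge (i : ι) : E := (hf.chart I).linear.symm fun j => if j = i then 1 else 0

theorem dual_apply_eq (w : Dual ℝ E) (x : E) :
    w x = w (hf.vertex I) + ∑ i : I.1, f i x * w (hf.edge I i) := by
  have hx : x - hf.vertex I = (hf.chart I).linear.symm fun i => f i x := by
    refine ((hf.chart I).linear.eq_symm_apply).2 (funext fun i => ?_)
    have hi := AffineMap.linearMap_vsub (f i) x (hf.vertex I)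
    rwa [hf.apply_vertex I i.2, vsub_eq_sub (f i x), sub_zero] at hi
  have hsum := (w ∘ₗ (hf.chart I).linear.symm.toLinearMap).pi_apply_eq_sum_univ fun i => f i x
  rw [← sub_eq_iff_eq_add', ← map_sub, hx]
  simpa [edge, eq_comm] using hsum

theorem edge_ne_zero (hi : i ∈ I.1) : hf.edge I i ≠ 0 :=
  (LinearEquiv.map_ne_zero_iff _).2 fun h => by simpa using congrFun h ⟨i, hi⟩

theorem exists_dual_edge_ne_zero [Finite ι] :
    ∃ w : Dual ℝ E, ∀ I, ∀ i ∈ I.1, w (hf.edge I i) ≠ 0 := by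
  obtain ⟨w, hw⟩ := exists_dual_forall_apply_ne_zero (K := ℝ)
    (fun p : Σ I : Set.powersetCard ι (finrank ℝ E), I.1 => hf.edge p.1 p.2)
    fun p => hf.edge_ne_zero p.1 p.2.2
  exact ⟨w, fun I i hi => hw ⟨I, i, hi⟩⟩

theorem vertex_mem_closedPolyhedron (hS : ∀ i ∉ I.1, i ∈ S ↔ f i (hf.vertex I) < 0) :
    hf.vertex I ∈ closedPolyhedron (reorient f S) := fun i => by
  by_cases hi : i ∈ I.1
  · exact (reorient_apply_eq_zero_iff.2 (hf.apply_vertex I hi)).ge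
  · rw [reorient_apply]
    split_ifs with hiS
    · exact (neg_pos.2 ((hS i hi).1 hiS)).le
    · exact not_lt.1 (mt (hS i hi).2 hiS)

theorem mem_signPatterns [Finite ι] (hS : ∀ i ∉ I.1, i ∈ S ↔ f i (hf.vertex I) < 0) :
    S ∈ signPatterns f := by
  let y := (hf.chart I).symm fun i => if (i : ι) ∈ S then -1 else 1
  have hpos : ∀ i, ∀ᶠ t in 𝓝[>] (0 : ℝ),
      0 < reorient f S i (AffineMap.lineMap (hf.vertex I) y t) := fun i => by
    by_cases hi : i ∈ I.1
    · filter_upwards [self_mem_nhdsWithin] with t ht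
      have hy : reorient f S i y = 1 := by
        rw [reorient_apply, hf.apply_chart_symm I hi]
        split_ifs <;> norm_num
      rw [AffineMap.apply_lineMap, AffineMap.lineMap_apply_ring, hy,
        reorient_apply_eq_zero_iff.2 (hf.apply_vertex I hi)]
      simpa using ht
    · refine eventually_lineMap_pos ((hf.vertex_mem_closedPolyhedron I hS i).lt_of_ne' ?_) y
      rwa [ne_eq, reorient_apply_eq_zero_iff, hf.apply_vertex_eq_zero_iff]
  obtain ⟨t, ht⟩ := (Filter.eventually_all.2 hpos).exists
  exact ⟨_, ht⟩

variable [Fintype ι] {w : Dual ℝ E} (hw : ∀ I, ∀ i ∈ I.1, w (hf.edge I i) ≠ 0)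

/-- The sign pattern of the region at the vertex of `I` into which all edges increasing `w` point:
the one on which `w` attains its minimum at that vertex. -/
noncomputable def minCell (w : Dual ℝ E) (I : Set.powersetCard ι (finrank ℝ E)) : Finset ι :=
  {i | if i ∈ I.1 then w (hf.edge I i) < 0 else f i (hf.vertex I) < 0}

theorem mem_minCell_of_mem (hi : i ∈ I.1) : i ∈ hf.minCell w I ↔ w (hf.edge I i) < 0 := by
  simp [minCell, hi]

theorem mem_minCell_of_notMem (hi : i ∉ I.1) :
    i ∈ hf.minCell w I ↔ f i (hf.vertex I) < 0 := by
  simp [minCell, hi]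

include hw in
theorem eq_vertex_of_dual_apply_le (hx : x ∈ closedPolyhedron (reorient f (hf.minCell w I)))
    (hle : w x ≤ w (hf.vertex I)) : x = hf.vertex I := by
  have hnonneg : ∀ i : I.1, 0 ≤ f i x * w (hf.edge I i) := fun i => by
    have hxi := hx i
    simp only [reorient_apply, hf.mem_minCell_of_mem I i.2] at hxi
    split_ifs at hxi with hi
    · exact mul_nonneg_of_nonpos_of_nonpos (neg_nonneg.1 hxi) hi.le
    · exact mul_nonneg hxi (not_lt.1 hi)
  have hsum : ∑ i : I.1, f i x * w (hf.edge I i) = 0 := by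
    refine le_antisymm ?_ (Finset.sum_nonneg fun i _ => hnonneg i)
    linarith [hf.dual_apply_eq I w x]
  refine hf.eq_vertex I fun i hi => ?_
  have hzero := (Fintype.sum_eq_zero_iff_of_nonneg hnonneg).1 hsum
  exact (mul_eq_zero.1 (congrFun hzero ⟨i, hi⟩)).resolve_right (hw I i hi)

include hw in
theorem minCell_injective : Injective (hf.minCell w) := fun I J h => by
  have hI := hf.vertex_mem_closedPolyhedron I fun i => hf.mem_minCell_of_notMem (w := w) I
  have hJ := hf.vertex_mem_closedPolyhedron J fun i => hf.mem_minCell_of_notMem (w := w) J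
  rcases le_total (w (hf.vertex J)) (w (hf.vertex I)) with hle | hle
  · exact hf.vertex_injective (hf.eq_vertex_of_dual_apply_le I hw (h ▸ hJ) hle).symm
  · exact hf.vertex_injective (hf.eq_vertex_of_dual_apply_le J hw (h ▸ hI) hle)

include hw in
theorem minCell_neg : hf.minCell (-w) I = hf.minCell w I ∆ I.1 := by
  ext i
  by_cases hi : i ∈ I.1
  · have := hw I i hi
    simp only [Finset.mem_symmDiff, hf.mem_minCell_of_mem I hi, hi, LinearMap.neg_apply]
    grind
  · simp [Finset.mem_symmDiff, hf.mem_minCell_of_notMem I hi, hi]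

theorem minCell_symmDiff_mem_signPatterns {J : Finset ι} (hJ : J ⊆ I.1) :
    hf.minCell w I ∆ J ∈ signPatterns f :=
  hf.mem_signPatterns I fun i hi => by
    rw [← hf.mem_minCell_of_notMem (w := w) I hi, Finset.mem_symmDiff]
    have := mt (@hJ i) hi
    tauto

theorem choose_le_two_mul_ncard_colorClass (hE : Odd (finrank ℝ E))
    (C : ((hypercubeGraph ι).induce (signPatterns f)).Coloring Bool) (k : Bool) :
    (Fintype.card ι).choose (finrank ℝ E) ≤ 2 * (C.colorClass k).ncard := by
  obtain ⟨w, hw⟩ := hf.exists_dual_edge_ne_zero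
  have hw_neg : ∀ I, ∀ i ∈ I.1, (-w) (hf.edge I i) ≠ 0 := fun I i hi => neg_ne_zero.2 (hw I i hi)
  have hmem : ∀ (u : Dual ℝ E) I, hf.minCell u I ∈ signPatterns f := fun u I =>
    hf.mem_signPatterns I fun i => hf.mem_minCell_of_notMem I
  have hne : ∀ I, C ⟨hf.minCell (-w) I, hmem (-w) I⟩ ≠ C ⟨hf.minCell w I, hmem w I⟩ := fun I => by
    simp only [hf.minCell_neg I hw]
    exact coloring_symmDiff_ne C (by rwa [Set.powersetCard.card_eq I])
      (fun J => hf.minCell_symmDiff_mem_signPatterns I) (hmem w I)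
  have hcount := card_le_two_mul_ncard_of_injective_of_ne
    (fun I J h => hf.minCell_injective hw_neg (congrArg Subtype.val h))
    (fun I J h => hf.minCell_injective hw (congrArg Subtype.val h)) hne k
  rwa [Set.powersetCard.card, Nat.card_eq_fintype_card] at hcount

end InGeneralPosition

end GeneralPosition

section ZeroSet

variable {K E F : Type*} [DivisionRing K] [AddCommGroup E] [Module K E] [AddCommGroup F]
  [Module K F]

theorem direction_eq_ker {φ : E →ᵃ[K] F} {H : AffineSubspace K E} (hH : ∀ x, x ∈ H ↔ φ x = 0)
    {p : E} (hp : p ∈ H) : H.direction = φ.linear.ker := by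
  ext v
  rw [← AffineSubspace.vadd_mem_iff_mem_direction v hp, hH, φ.map_vadd, (hH p).1 hp, vadd_eq_add,
    add_zero, LinearMap.mem_ker]

variable [FiniteDimensional K E]

theorem surjective_iff_finrank_direction [FiniteDimensional K F] {φ : E →ᵃ[K] F}
    {H : AffineSubspace K E} (hH : ∀ x, x ∈ H ↔ φ x = 0) :
    Surjective φ ↔
      (H : Set E).Nonempty ∧ finrank K H.direction + finrank K F = finrank K E := by
  have hrank := φ.linear.finrank_range_add_finrank_ker
  rw [← AffineMap.linear_surjective_iff, ← LinearMap.range_eq_top]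
  constructor
  · intro htop
    obtain ⟨p, hp⟩ := (AffineMap.linear_surjective_iff φ).1 (LinearMap.range_eq_top.1 htop) 0
    rw [htop, finrank_top, ← direction_eq_ker hH ((hH p).2 hp), add_comm] at hrank
    exact ⟨⟨p, (hH p).2 hp⟩, hrank⟩
  · rintro ⟨⟨p, hp⟩, hfinrank⟩
    rw [← direction_eq_ker hH hp] at hrank
    exact Submodule.eq_top_of_finrank_eq (by omega)

theorem exists_affineMap_zeroSet_eq {H : AffineSubspace K E} (hne : (H : Set E).Nonempty)
    (hH : finrank K H.direction + 1 = finrank K E) :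
    ∃ φ : E →ᵃ[K] K, ∀ x, x ∈ H ↔ φ x = 0 := by
  obtain ⟨p, hp⟩ := hne
  have hlt : H.direction < ⊤ := lt_top_iff_ne_top.2 fun htop => by
    rw [htop, finrank_top] at hH
    omega
  obtain ⟨l, hl, hle⟩ := Submodule.exists_le_ker_of_lt_top _ hlt
  have hker : H.direction = l.ker := Submodule.eq_of_le_of_finrank_eq hle <|
    Nat.succ_injective (hH.trans (Module.Dual.finrank_ker_add_one_of_ne_zero hl).symm)
  refine ⟨l.toAffineMap.comp (AffineEquiv.vaddConst K p).symm.toAffineMap, fun x => ?_⟩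
  rw [← AffineSubspace.vsub_right_mem_direction_iff_mem hp, hker]
  rfl

end ZeroSet

namespace HyperplaneArrangement

variable {d n : ℕ} {A : HyperplaneArrangement d n} {S T : Finset (Fin n)} {i : Fin n}
  {x : EuclideanSpace ℝ (Fin d)}

theorem exists_form (A : HyperplaneArrangement d n) (i : Fin n) :
    ∃ φ : EuclideanSpace ℝ (Fin d) →ᵃ[ℝ] ℝ, ∀ x, x ∈ A.hyperplane i ↔ φ x = 0 :=
  exists_affineMap_zeroSet_eq (A.nonempty i)
    ((A.finrank_direction i).trans finrank_euclideanSpace_fin.symm)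

/-- A chosen affine functional with zero set the `i`-th hyperplane. -/
noncomputable def form (A : HyperplaneArrangement d n) (i : Fin n) :
    EuclideanSpace ℝ (Fin d) →ᵃ[ℝ] ℝ :=
  (A.exists_form i).choose

theorem mem_hyperplane_iff : x ∈ A.hyperplane i ↔ A.form i x = 0 :=
  (A.exists_form i).choose_spec x

theorem continuous_form (A : HyperplaneArrangement d n) (i : Fin n) : Continuous (A.form i) :=
  (A.form i).continuous_of_finiteDimensional

theorem continuous_reorient_form (A : HyperplaneArrangement d n) (S : Finset (Fin n)) (i : Fin n) :
    Continuous (reorient A.form S i) :=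
  continuous_reorient A.continuous_form S i

theorem isSimple_iff_inGeneralPosition {f : Fin n → EuclideanSpace ℝ (Fin d) →ᵃ[ℝ] ℝ}
    (hf : ∀ i x, x ∈ A.hyperplane i ↔ f i x = 0) : A.IsSimple ↔ InGeneralPosition f := by
  have hmem : ∀ (S : Finset (Fin n)) x, x ∈ ⨅ i ∈ S, A.hyperplane i ↔ ∀ i ∈ S, f i x = 0 :=
    fun S x => by simp only [AffineSubspace.mem_iInf_iff, hf]
  have hcoe : ∀ S : Finset (Fin n), (⋂ i ∈ S, (A.hyperplane i : Set (EuclideanSpace ℝ (Fin d)))) =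
      (⨅ i ∈ S, A.hyperplane i : AffineSubspace ℝ (EuclideanSpace ℝ (Fin d))) := fun S => by
    simp only [AffineSubspace.coe_iInf]
  have hsurj : ∀ S : Finset (Fin n), Surjective (AffineMap.pi fun i : S => f i) ↔
      (⋂ i ∈ S, (A.hyperplane i : Set (EuclideanSpace ℝ (Fin d)))).Nonempty ∧
        finrank ℝ (⨅ i ∈ S, A.hyperplane i).direction + #S = d := fun S => by
    rw [surjective_iff_finrank_direction (H := ⨅ i ∈ S, A.hyperplane i) fun x => by
      simp [hmem, funext_iff], hcoe]
    simp
  have hempty : ∀ S : Finset (Fin n),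
      (⋂ i ∈ S, (A.hyperplane i : Set (EuclideanSpace ℝ (Fin d)))) = ∅ ↔
        ¬ ∃ x, ∀ i ∈ S, f i x = 0 := fun S => by
    rw [hcoe, Set.eq_empty_iff_forall_notMem, not_exists]
    exact forall_congr' fun x => not_congr (hmem S x)
  constructor
  · rintro ⟨hmeet, hdisj⟩
    refine ⟨fun S hS => (hsurj S).2 (hmeet S (by simpa using hS)), fun S x hx => ?_⟩
    rw [finrank_euclideanSpace_fin]
    by_contra! hlt
    exact (hempty S).1 (hdisj S hlt) ⟨x, hx⟩
  · refine fun h => ⟨fun S hS => (hsurj S).1 (h.surjective_pi S (by simpa using hS)),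
      fun S hlt => (hempty S).2 fun ⟨x, hx⟩ => hlt.not_ge ?_⟩
    simpa using h.card_le_finrank S x hx

theorem complement_eq : A.complement = {x | ∀ i, A.form i x ≠ 0} := by
  ext x
  simp [complement, mem_hyperplane_iff]

theorem topes_eq_image :
    A.topes = (fun S => openPolyhedron (reorient A.form S)) '' signPatterns A.form := by
  ext t
  simp only [topes, complement_eq, Set.mem_ofPred_eq, Set.mem_image]
  constructor
  · rintro ⟨x, hx, rfl⟩
    obtain ⟨S, hS⟩ := exists_mem_openPolyhedron_reorient hx
    exact ⟨S, ⟨x, hS⟩, (connectedComponentIn_eq_openPolyhedron A.continuous_form hS).symm⟩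
  · rintro ⟨S, ⟨x, hx⟩, rfl⟩
    exact ⟨x, fun i => (mem_openPolyhedron_reorient_iff.1 hx i).1,
      (connectedComponentIn_eq_openPolyhedron A.continuous_form hx).symm⟩

theorem finite_topes (A : HyperplaneArrangement d n) : A.topes.Finite := by
  rw [topes_eq_image]
  exact (Set.toFinite _).image _

/-- Topes correspond to sign patterns of the defining functionals. -/
noncomputable def topeEquiv (A : HyperplaneArrangement d n) : signPatterns A.form ≃ A.topes :=
  (Equiv.Set.imageOfInjOn _ _ openPolyhedron_reorient_injOn).trans (.setCongr topes_eq_image.symm)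

theorem closure_topeEquiv (S : signPatterns A.form) :
    closure (A.topeEquiv S : Set (EuclideanSpace ℝ (Fin d))) =
      closedPolyhedron (reorient A.form S) :=
  closure_openPolyhedron (A.continuous_reorient_form S) S.2

theorem isFacet_closedPolyhedron_inter (hS : S ∈ signPatterns A.form)
    (hT : T ∈ signPatterns A.form) (h : S ∆ T = {i}) :
    IsFacet (closedPolyhedron (reorient A.form S))
      (closedPolyhedron (reorient A.form S) ∩ closedPolyhedron (reorient A.form T)) := by
  obtain ⟨r, hri, hr⟩ := exists_mem_wall_reorient h hS hT
  rw [closedPolyhedron_reorient_inter_eq_wall h]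
  refine ⟨⟨r, mem_wall_of_pos hri hr⟩, isExposed_wall (A.continuous_reorient_form S i), ?_⟩
  rw [affineSpan_wall (H := A.hyperplane i) (fun x => ?_) hri hr]
  · exact A.finrank_direction i
  · rw [mem_hyperplane_iff, reorient_apply_eq_zero_iff]

theorem IsSimple.card_symmDiff_le_one (hA : A.IsSimple)
    (h : IsFacet (closedPolyhedron (reorient A.form S))
      (closedPolyhedron (reorient A.form S) ∩ closedPolyhedron (reorient A.form T))) :
    #(S ∆ T) ≤ 1 := by
  rw [closedPolyhedron_reorient_inter] at h
  obtain ⟨⟨x, -, hx⟩, -, hdim⟩ := h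
  have hcard : #(S ∆ T) ≤ d := by
    by_contra! hlt
    exact Set.eq_empty_iff_forall_notMem.1 (hA.2 (S ∆ T) hlt) x
      (Set.mem_iInter₂.2 fun i hi => mem_hyperplane_iff.2 (hx i hi))
  have hspan : affineSpan ℝ {x ∈ closedPolyhedron (reorient A.form S) |
      ∀ i ∈ S ∆ T, A.form i x = 0} ≤ ⨅ i ∈ S ∆ T, A.hyperplane i :=
    le_iInf₂ fun i hi => affineSpan_le.2 fun y hy => mem_hyperplane_iff.2 (hy.2 i hi)
  have hmono := Submodule.finrank_mono (AffineSubspace.direction_le hspan)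
  have hfinrank := (hA.1 (S ∆ T) hcard).2
  omega

theorem IsSimple.topeGraph_adj_topeEquiv_iff (hA : A.IsSimple) {S T : signPatterns A.form} :
    A.topeGraph.Adj (A.topeEquiv S) (A.topeEquiv T) ↔ (hypercubeGraph (Fin n)).Adj S T := by
  rw [hypercubeGraph_adj_iff]
  change A.topeEquiv S ≠ A.topeEquiv T ∧ _ ∧ _ ↔ _
  rw [closure_topeEquiv, closure_topeEquiv, A.topeEquiv.injective.ne_iff]
  constructor
  · rintro ⟨hne, hfacet, -⟩
    have hpos : 0 < #(S.1 ∆ T.1) :=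
      Finset.card_pos.2 (Finset.symmDiff_nonempty.2 (Subtype.coe_ne_coe.2 hne))
    exact Finset.card_eq_one.1 (le_antisymm (hA.card_symmDiff_le_one hfacet) hpos)
  · rintro ⟨i, hi⟩
    refine ⟨?_, isFacet_closedPolyhedron_inter S.2 T.2 hi, ?_⟩
    · rintro rfl
      simp at hi
    · rw [Set.inter_comm]
      exact isFacet_closedPolyhedron_inter T.2 S.2 (symmDiff_comm S.1 T.1 ▸ hi)

/-- The tope graph of a simple arrangement as an induced subgraph of the hypercube graph. -/
noncomputable def IsSimple.topeGraphIso (hA : A.IsSimple) :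
    (hypercubeGraph (Fin n)).induce (signPatterns A.form) ≃g A.topeGraph :=
  ⟨A.topeEquiv, hA.topeGraph_adj_topeEquiv_iff⟩

theorem IsSimple.ncard_colorClass_comp (hA : A.IsSimple) (C : A.topeGraph.Coloring Bool)
    (k : Bool) :
    (SimpleGraph.Coloring.colorClass (C.comp hA.topeGraphIso.toHom) k).ncard = A.numTopes C k :=
  Set.ncard_preimage_of_injective_subset_range (s := C.colorClass k) A.topeEquiv.injective
    (A.topeEquiv.range_eq_univ ▸ Set.subset_univ _)

theorem IsSimple.choose_le_two_mul_numTopes (hA : A.IsSimple) (hd : Odd d)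
    (C : A.topeGraph.Coloring Bool) (k : Bool) : n.choose d ≤ 2 * A.numTopes C k := by
  have hf := (isSimple_iff_inGeneralPosition fun i x => mem_hyperplane_iff).1 hA
  have hle := hf.choose_le_two_mul_ncard_colorClass (by rwa [finrank_euclideanSpace_fin])
    (C.comp hA.topeGraphIso.toHom) k
  rwa [hA.ncard_colorClass_comp, finrank_euclideanSpace_fin, Fintype.card_fin] at hle

theorem numTopes_true_add_numTopes_false_le (C : A.topeGraph.Coloring Bool) :
    A.numTopes C true + A.numTopes C false ≤ ∑ k ∈ Finset.range (d + 1), n.choose k := by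
  have hfin := A.finite_topes.to_subtype
  have hcompl : C.colorClass false = (C.colorClass true)ᶜ :=
    Set.ext fun T => (Bool.not_eq_true (C T)).symm.to_iff
  have hle := ncard_signPatterns_le A.form
  rw [finrank_euclideanSpace_fin, Fintype.card_fin] at hle
  rwa [numTopes, numTopes, hcompl, Set.ncard_add_ncard_compl, ← Nat.card_congr A.topeEquiv]

end HyperplaneArrangement

section GrowthOfBinomials

open Asymptotics Filter

/-- Twice the ratio of `∑ k < d, n.choose k` to `n.choose d`: a bound, uniform over all simple
arrangements of `n` hyperplanes in `ℝ^d`, for the excess over `1` of the ratio of the sizes of the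
two colour classes. -/
noncomputable def ratioExcess (d n : ℕ) : ℝ :=
  2 * (∑ k ∈ Finset.range d, (n.choose k : ℝ)) / n.choose d

theorem isLittleO_choose_of_lt {k d : ℕ} (hkd : k < d) :
    (fun n : ℕ => (n.choose k : ℝ)) =o[atTop] fun n => (n.choose d : ℝ) :=
  have hpow : (fun n : ℕ => (n : ℝ) ^ k) =o[atTop] fun n => (n : ℝ) ^ d :=
    (isLittleO_pow_pow_atTop_of_lt hkd).comp_tendsto tendsto_natCast_atTop_atTop
  ((isTheta_choose k).isBigO.trans_isLittleO hpow).trans_isBigO (isTheta_choose d).symm.isBigO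

theorem tendsto_ratioExcess (d : ℕ) : Tendsto (ratioExcess d) atTop (𝓝 0) :=
  ((IsLittleO.fun_sum fun _ hk =>
    isLittleO_choose_of_lt (Finset.mem_range.1 hk)).const_mul_left 2).tendsto_div_nhds_zero

end GrowthOfBinomials

namespace HyperplaneArrangement

variable {d n : ℕ} {A : HyperplaneArrangement d n}

theorem IsSimple.numTopes_pos (hA : A.IsSimple) (hd : Odd d) (hdn : d ≤ n)
    (C : A.topeGraph.Coloring Bool) (k : Bool) : 0 < A.numTopes C k :=
  pos_of_mul_pos_right ((Nat.choose_pos hdn).trans_le (hA.choose_le_two_mul_numTopes hd C k))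
    (Nat.zero_le 2)

theorem IsSimple.numTopes_true_div_numTopes_false_le (hA : A.IsSimple) (hd : Odd d) (hdn : d ≤ n)
    (C : A.topeGraph.Coloring Bool) :
    (A.numTopes C true : ℝ) / A.numTopes C false ≤ 1 + ratioExcess d n := by
  have hchoose : (0 : ℝ) < n.choose d := mod_cast Nat.choose_pos hdn
  have hpos : (0 : ℝ) < A.numTopes C false := mod_cast hA.numTopes_pos hd hdn C false
  have hfalse : (n.choose d : ℝ) ≤ 2 * A.numTopes C false :=
    mod_cast hA.choose_le_two_mul_numTopes hd C false
  have hadd : (A.numTopes C true + A.numTopes C false : ℝ) ≤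
      ∑ k ∈ Finset.range d, (n.choose k : ℝ) + n.choose d := by
    rw [← Finset.sum_range_succ]
    exact_mod_cast numTopes_true_add_numTopes_false_le C
  set R : ℝ := ∑ k ∈ Finset.range d, (n.choose k : ℝ)
  have hR : R ≤ A.numTopes C false * ratioExcess d n := by
    have hR0 : 0 ≤ R := Finset.sum_nonneg fun k _ => Nat.cast_nonneg _
    rw [ratioExcess, mul_div_assoc', le_div_iff₀ hchoose]
    linarith [mul_le_mul_of_nonneg_left hfalse hR0]
  rw [div_le_iff₀ hpos]
  linarith

end HyperplaneArrangement

section MomentCurve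

open Polynomial

variable {d : ℕ} {ι : Type*} {t : ι → ℝ}

/-- The point of `ℝ^d` whose coordinates are the coefficients of a polynomial of degree `< d`. -/
noncomputable def coeffEquiv (d : ℕ) : degreeLT ℝ d ≃ₗ[ℝ] EuclideanSpace ℝ (Fin d) :=
  (degreeLTEquiv ℝ d).trans (WithLp.linearEquiv 2 ℝ (Fin d → ℝ)).symm

/-- The value at `t` of the monic polynomial of degree `d` with prescribed lower coefficients. As
`t` varies, the normals of the zero sets run along the moment curve `(1, t, …, t ^ (d - 1))`. -/
noncomputable def momentFunctional (d : ℕ) (t : ℝ) : EuclideanSpace ℝ (Fin d) →ᵃ[ℝ] ℝ :=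
  (leval t ∘ₗ (degreeLT ℝ d).subtype ∘ₗ (coeffEquiv d).symm.toLinearMap).toAffineMap +
    AffineMap.const ℝ _ (t ^ d)

theorem momentFunctional_apply (t : ℝ) (x : EuclideanSpace ℝ (Fin d)) :
    momentFunctional d t x = (X ^ d + ((coeffEquiv d).symm x : ℝ[X])).eval t := by
  simp [momentFunctional, add_comm]

theorem surjective_pi_momentFunctional {S : Finset ι} (ht : Set.InjOn t S) (hS : #S ≤ d) :
    Surjective (AffineMap.pi fun i : S => momentFunctional d (t i)) := fun y => by
  classical
  have hinj : Set.InjOn (fun i : S => t i) (Finset.univ : Finset S) := fun i _ j _ h =>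
    Subtype.ext (ht i.2 j.2 h)
  set p : ℝ[X] := Lagrange.interpolate Finset.univ (fun i : S => t i) fun i => y i - t i ^ d
  have hp : p ∈ degreeLT ℝ d := mem_degreeLT.2 <|
    (Lagrange.degree_interpolate_lt _ hinj).trans_le <| by simpa using hS
  refine ⟨coeffEquiv d ⟨p, hp⟩, funext fun i => ?_⟩
  change momentFunctional d (t i) _ = y i
  rw [momentFunctional_apply, LinearEquiv.symm_apply_apply, eval_add,
    Lagrange.eval_interpolate_at_node _ hinj (Finset.mem_univ i), eval_pow, eval_X,
    add_sub_cancel]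

theorem card_le_of_momentFunctional_eq_zero {S : Finset ι} (ht : Set.InjOn t S)
    {x : EuclideanSpace ℝ (Fin d)} (hx : ∀ i ∈ S, momentFunctional d (t i) x = 0) : #S ≤ d := by
  classical
  set p : ℝ[X] := ((coeffEquiv d).symm x).1
  have hp : p.degree < d := mem_degreeLT.1 ((coeffEquiv d).symm x).2
  have hmonic : (X ^ d + p).Monic := monic_X_pow_add hp
  have hroots : (S.image t).val ⊆ (X ^ d + p).roots := fun s hs => by
    obtain ⟨i, hi, rfl⟩ := Finset.mem_image.1 hs
    exact (mem_roots hmonic.ne_zero).2 ((momentFunctional_apply (t i) x).symm.trans (hx i hi))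
  rw [← Finset.card_image_of_injOn ht]
  exact (card_le_degree_of_subset_roots hroots).trans <|
    natDegree_le_of_degree_le <| (degree_add_le _ _).trans <| max_le (degree_X_pow_le d) hp.le

theorem inGeneralPosition_momentFunctional (ht : Injective t) :
    InGeneralPosition fun i => momentFunctional d (t i) where
  surjective_pi _ hS := surjective_pi_momentFunctional ht.injOn (by simpa using hS)
  card_le_finrank S x hx := by
    simpa using card_le_of_momentFunctional_eq_zero ht.injOn hx

end MomentCurve

theorem InGeneralPosition.exists_isSimple {d n : ℕ} {f : Fin n → EuclideanSpace ℝ (Fin d) →ᵃ[ℝ] ℝ}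
    (hf : InGeneralPosition f) (hd : 0 < d) : ∃ A : HyperplaneArrangement d n, A.IsSimple := by
  let H (i : Fin n) : AffineSubspace ℝ (EuclideanSpace ℝ (Fin d)) :=
    (AffineSubspace.mk' 0 ⊥).comap (f i)
  have hH : ∀ i x, x ∈ H i ↔ f i x = 0 := fun i x => by simp [H, AffineSubspace.mem_mk']
  have hsurj : ∀ i, Surjective (f i) := fun i y => by
    obtain ⟨x, hx⟩ := hf.surjective_pi {i} (by simpa using Nat.one_le_of_lt hd) fun _ => y
    exact ⟨x, congrFun hx ⟨i, Finset.mem_singleton_self i⟩⟩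
  have hfinrank := fun i => (surjective_iff_finrank_direction (hH i)).1 (hsurj i)
  let A : HyperplaneArrangement d n :=
    { hyperplane := H
      nonempty := fun i => (hfinrank i).1
      finrank_direction := fun i => by simpa using (hfinrank i).2 }
  exact ⟨A, (HyperplaneArrangement.isSimple_iff_inGeneralPosition hH).2 hf⟩

theorem exists_isSimple {d : ℕ} (hd : 0 < d) (n : ℕ) :
    ∃ A : HyperplaneArrangement d n, A.IsSimple :=
  (inGeneralPosition_momentFunctional
    (Nat.cast_injective.comp (Fin.val_injective (n := n)))).exists_isSimple hd

namespace HyperplaneArrangement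

variable {d n : ℕ} {A : HyperplaneArrangement d n}

theorem IsSimple.nonempty_coloring (hA : A.IsSimple) : Nonempty (A.topeGraph.Coloring Bool) :=
  ⟨(parityColoring (Fin n)).comp
    ((SimpleGraph.Embedding.induce _).toHom.comp hA.topeGraphIso.symm.toHom)⟩

theorem exists_numTopes_false_le_numTopes_true (C : A.topeGraph.Coloring Bool) :
    ∃ C' : A.topeGraph.Coloring Bool, A.numTopes C' false ≤ A.numTopes C' true := by
  rcases le_total (A.numTopes C false) (A.numTopes C true) with h | h
  · exact ⟨C, h⟩
  · let C' := A.topeGraph.recolorOfEquiv Equiv.boolNot C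
    have hswap : ∀ k, A.numTopes C' k = A.numTopes C !k := fun k =>
      congrArg Set.ncard (Set.ext fun T => Bool.not_eq_eq_eq_not)
    exact ⟨C', by rwa [hswap, hswap]⟩

end HyperplaneArrangement

section SupTopeRatio

open Filter HyperplaneArrangement

variable {d n : ℕ}

theorem one_le_supTopeRatio (hd : Odd d) (hdn : d ≤ n) : 1 ≤ supTopeRatio d n := by
  obtain ⟨A, hA⟩ := exists_isSimple hd.pos n
  obtain ⟨C, hC⟩ := exists_numTopes_false_le_numTopes_true hA.nonempty_coloring.some
  refine le_iSup_of_le A (le_iSup₂_of_le hA C ?_)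
  have hpos := hA.numTopes_pos hd hdn C false
  rw [ENNReal.le_div_iff_mul_le (.inl (mod_cast hpos.ne')) (.inl (ENNReal.natCast_ne_top _)),
    one_mul]
  exact_mod_cast hC

theorem supTopeRatio_le (hd : Odd d) (hdn : d ≤ n) :
    supTopeRatio d n ≤ ENNReal.ofReal (1 + ratioExcess d n) :=
  iSup_le fun A => iSup₂_le fun hA C => by
    have hle := hA.numTopes_true_div_numTopes_false_le hd hdn C
    have hpos := hA.numTopes_pos hd hdn C false
    rw [← ENNReal.ofReal_natCast, ← ENNReal.ofReal_natCast,
      ← ENNReal.ofReal_div_of_pos (mod_cast hpos)]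
    exact ENNReal.ofReal_le_ofReal hle

theorem tendsto_supTopeRatio (hd : Odd d) : Tendsto (supTopeRatio d) atTop (𝓝 1) := by
  have hupper : Tendsto (fun n => ENNReal.ofReal (1 + ratioExcess d n)) atTop (𝓝 1) := by
    simpa using ENNReal.tendsto_ofReal ((tendsto_ratioExcess d).const_add 1)
  refine tendsto_of_tendsto_of_tendsto_of_le_of_le' tendsto_const_nhds hupper ?_ ?_
  · exact (eventually_ge_atTop d).mono fun n hdn => one_le_supTopeRatio hd hdn
  · exact (eventually_ge_atTop d).mono fun n hdn => supTopeRatio_le hd hdn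

end SupTopeRatio

theorem theorem10 (d : ℕ) (hd : Odd d) :
    (∀ ε : ℝ, 0 < ε → ∃ N : ℕ, ∀ n : ℕ, N ≤ n →
      ∀ A : HyperplaneArrangement d n, A.IsSimple →
        ∀ C : A.topeGraph.Coloring Bool,
          A.topes.Finite ∧ 0 < A.numTopes C false ∧
            (A.numTopes C true : ℝ) / (A.numTopes C false : ℝ) ≤ 1 + ε) ∧
    Filter.limsup (fun n : ℕ => supTopeRatio d n) Filter.atTop = 1 := by
  refine ⟨fun ε hε => ?_, (tendsto_supTopeRatio hd).limsup_eq⟩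
  have hsmall := (tendsto_ratioExcess d).eventually (eventually_le_nhds hε)
  obtain ⟨N, hN⟩ :=
    Filter.eventually_atTop.1 (hsmall.and (Filter.eventually_ge_atTop d))
  refine ⟨N, fun n hNn A hA C => ?_⟩
  obtain ⟨hratio, hdn⟩ := hN n hNn
  have hle := hA.numTopes_true_div_numTopes_false_le hd hdn C
  exact ⟨A.finite_topes, hA.numTopes_pos hd hdn C false, by linarith⟩
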